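/- Let $T$ be a complex $n\times n$ matrix. Then $T$ is similar to a complex $n \times n$ matrix $X$ satisfying $XX^*X - X^2 = 0$ (where $X^*$ is the conjugate transpose) if and only if the following three conditions hold: (a) the spectrum of $T$ is contained in the real interval $[0,1]$; (b) for each eigenvalue of $T$, the geometric and algebraic multiplicities are equal (that is, $T$ is diagonalizable); (c) the nullity of $T$ is at least as great as the sum of the nullities of $T - cI$ over all $c \in (0,1)$, i.e. $\dim\ker T \ge \sum_{c\in(0,1)} \dim\ker(T-cI)$, where only finitely many terms of the sum are nonzero. -/

import Mathlib

/-- The nullity of a complex square matrix: the dimension of its null space. -/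
noncomputable def matrixNullity {n : ℕ} (A : Matrix (Fin n) (Fin n) ℂ) : ℕ :=
  Module.finrank ℂ (LinearMap.ker A.mulVecLin)

/-- The geometric multiplicity of `z` for `A`: the nullity of `A - z I`. -/
noncomputable def geometricMultiplicity {n : ℕ} (A : Matrix (Fin n) (Fin n) ℂ) (z : ℂ) : ℕ :=
  matrixNullity (A - z • (1 : Matrix (Fin n) (Fin n) ℂ))

/-- The algebraic multiplicity of `z` for `A`: its multiplicity as a root of the
characteristic polynomial. -/
noncomputable def algebraicMultiplicity {n : ℕ} (A : Matrix (Fin n) (Fin n) ℂ) (z : ℂ) : ℕ :=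
  A.charpoly.rootMultiplicity z

/-- `A - c I` has positive nullity for only finitely many real `c`, so that the sum of the
nullities over a set of real numbers `c` is a finite sum, which `finsum` computes. -/
theorem finite_support_nullity {n : ℕ} (A : Matrix (Fin n) (Fin n) ℂ) :
    (Function.support fun c : ℝ =>
      matrixNullity (A - (c : ℂ) • (1 : Matrix (Fin n) (Fin n) ℂ))).Finite := by
  have hfin : (spectrum ℂ A).Finite := Matrix.finite_spectrum A
  refine (hfin.preimage (f := fun c : ℝ => (c : ℂ))
    Complex.ofReal_injective.injOn).subset ?_
  intro c hc
  rw [Set.mem_preimage, spectrum.mem_iff]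
  intro hu
  apply hc
  have hu' : IsUnit (A - (c : ℂ) • (1 : Matrix (Fin n) (Fin n) ℂ)) := by
    have := hu.neg
    rwa [neg_sub, Algebra.algebraMap_eq_smul_one] at this
  have hker : LinearMap.ker
      (A - (c : ℂ) • (1 : Matrix (Fin n) (Fin n) ℂ)).mulVecLin = ⊥ := by
    rw [LinearMap.ker_eq_bot]
    exact Matrix.mulVec_injective_of_isUnit hu'
  simp only [matrixNullity]
  rw [hker]
  exact finrank_bot ℂ _

open Matrix

/-! On the range of `X` the equation says `X X* = X`, so `X` acts there as a positive self-adjoint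
operator. Hence nonzero eigenvalues are positive and semisimple
(`mulVec_eq_smul_of_sub_mulVec_sub`), and `‖X* v - v‖² ≥ 0` bounds them by 1 (`eigenvalue_mem_Icc`).
On the span of the eigenvectors with eigenvalue in `(0,1)`, `X* - 1` is injective with values in
`ker X`, whence (c) (`card_Ioo_le_matrixNullity`).

Conversely, `T` is similar to a real diagonal matrix, and (c) pairs each eigenvalue `r` in `(0,1)`
with a zero eigenvalue of its own. Then `diag(r, 0)` is similar to `[[r, √(r - r²)], [0, 0]]`, which
solves the equation; unpaired entries 0 and 1 already do (`exists_isConj_diagonal_of_card_le`). -/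

/-! ### Similarity invariants -/

theorem matrixNullity_eq_of_isConj {n : ℕ} {A B : Matrix (Fin n) (Fin n) ℂ} (h : IsConj A B) :
    matrixNullity A = matrixNullity B := by
  obtain ⟨u, hu⟩ := h
  have h1 : (u.1 * A).rank = A.rank :=
    rank_mul_eq_right_of_isUnit_det _ _ ((isUnit_iff_isUnit_det _).1 u.isUnit)
  have h2 : (B * u.1).rank = B.rank :=
    rank_mul_eq_left_of_isUnit_det _ _ ((isUnit_iff_isUnit_det _).1 u.isUnit)
  rw [hu.eq, h2] at h1
  have hA := LinearMap.finrank_range_add_finrank_ker A.mulVecLin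
  have hB := LinearMap.finrank_range_add_finrank_ker B.mulVecLin
  unfold Matrix.rank at h1
  unfold matrixNullity
  omega

theorem isConj_sub_smul_one {n : ℕ} {A B : Matrix (Fin n) (Fin n) ℂ} (h : IsConj A B) (c : ℂ) :
    IsConj (A - c • (1 : Matrix (Fin n) (Fin n) ℂ)) (B - c • 1) := by
  obtain ⟨u, hu⟩ := h
  refine ⟨u, ?_⟩
  simp only [SemiconjBy, mul_sub, sub_mul, hu.eq, mul_smul_comm, smul_mul_assoc, mul_one, one_mul]

theorem geometricMultiplicity_eq_of_isConj {n : ℕ} {A B : Matrix (Fin n) (Fin n) ℂ}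
    (h : IsConj A B) (c : ℂ) : geometricMultiplicity A c = geometricMultiplicity B c :=
  matrixNullity_eq_of_isConj (isConj_sub_smul_one h c)

theorem charpoly_eq_of_isConj {n : ℕ} {A B : Matrix (Fin n) (Fin n) ℂ} (h : IsConj A B) :
    A.charpoly = B.charpoly := by
  obtain ⟨u, hu⟩ := h
  rw [← charpoly_units_conj u A, hu.eq, mul_assoc, ← coe_units_inv, u.mul_inv, mul_one]

theorem spectrum_eq_of_isConj {n : ℕ} {A B : Matrix (Fin n) (Fin n) ℂ} (h : IsConj A B) :
    spectrum ℂ A = spectrum ℂ B := by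
  obtain ⟨u, hu⟩ := h
  rw [← spectrum.units_conjugate (a := A) (u := u), hu.eq, mul_assoc, u.mul_inv, mul_one]

/-! ### Diagonalization from equal multiplicities -/

theorem mulVec_eq_smul_of_mem_eigenspace {n : ℕ} {T : Matrix (Fin n) (Fin n) ℂ} {z : ℂ}
    {v : Fin n → ℂ} (hv : v ∈ Module.End.eigenspace (toLin' T) z) : T *ᵥ v = z • v := by
  simpa using Module.End.mem_eigenspace_iff.1 hv

theorem geometricMultiplicity_eq_finrank_eigenspace {n : ℕ} (T : Matrix (Fin n) (Fin n) ℂ)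
    (z : ℂ) : geometricMultiplicity T z =
      Module.finrank ℂ (Module.End.eigenspace (toLin' T) z) := by
  have : LinearMap.ker (T - z • (1 : Matrix (Fin n) (Fin n) ℂ)).mulVecLin =
      Module.End.eigenspace (toLin' T) z := by
    ext v
    simp [sub_eq_zero]
  unfold geometricMultiplicity matrixNullity
  rw [this]

theorem algebraicMultiplicity_eq_finrank_maxGenEigenspace {n : ℕ}
    (T : Matrix (Fin n) (Fin n) ℂ) (z : ℂ) : algebraicMultiplicity T z =
      Module.finrank ℂ (Module.End.maxGenEigenspace (toLin' T) z) := by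
  rw [LinearMap.finrank_maxGenEigenspace_eq, charpoly_toLin', algebraicMultiplicity]

/-- A complex matrix whose eigenvectors span is similar to a diagonal matrix. -/
theorem exists_isConj_diagonal_of_iSup_eigenspace_eq_top {n : ℕ} (T : Matrix (Fin n) (Fin n) ℂ)
    (h : ⨆ z, Module.End.eigenspace (toLin' T) z = ⊤) :
    ∃ d : Fin n → ℂ, IsConj T (diagonal d) := by
  classical
  have hint : DirectSum.IsInternal fun z => Module.End.eigenspace (toLin' T) z :=
    (DirectSum.isInternal_submodule_iff_iSupIndep_and_iSup_eq_top _).2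
      ⟨Module.End.eigenspaces_iSupIndep _, h⟩
  let b := hint.collectedBasis fun z =>
    Module.finBasis ℂ (Module.End.eigenspace (toLin' T) z)
  let e := b.indexEquiv (Pi.basisFun ℂ (Fin n))
  let b' := b.reindex e
  let d : Fin n → ℂ := fun i => (e.symm i).1
  have hd : ∀ i, T *ᵥ (b' i) = d i • b' i := fun i => by
    apply mulVec_eq_smul_of_mem_eigenspace
    simp only [b', Module.Basis.reindex_apply]
    exact hint.collectedBasis_mem _ _
  let Q : Matrix (Fin n) (Fin n) ℂ := (Pi.basisFun ℂ (Fin n)).toMatrix b'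
  have hQ : ∀ i, Q.col i = b' i := fun i => by
    ext j; simp [Q, Module.Basis.toMatrix_apply, Matrix.col]
  have hu : IsUnit Q := by
    have := (Pi.basisFun ℂ (Fin n)).invertibleToMatrix b'
    exact isUnit_of_invertible Q
  obtain ⟨u, hu⟩ := hu
  refine ⟨d, IsConj.symm ⟨u, ?_⟩⟩
  rw [SemiconjBy, hu]
  ext i j
  rw [mul_diagonal]
  have h1 := congrFun (hd j) i
  rw [← hQ j] at h1
  simp only [mulVec, dotProduct, Matrix.col, Pi.smul_apply, smul_eq_mul, Matrix.transpose_apply] at h1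
  rw [mul_apply, h1, mul_comm]

/-- Generalized eigenspaces span over `ℂ`, and equal dimensions force each to coincide with its
eigenspace. -/
theorem exists_isConj_diagonal {n : ℕ} (T : Matrix (Fin n) (Fin n) ℂ)
    (h : ∀ z ∈ spectrum ℂ T, geometricMultiplicity T z = algebraicMultiplicity T z) :
    ∃ d : Fin n → ℂ, IsConj T (diagonal d) := by
  apply exists_isConj_diagonal_of_iSup_eigenspace_eq_top
  rw [eq_top_iff, ← Module.End.iSup_maxGenEigenspace_eq_top (toLin' T)]
  refine iSup_mono fun z => ?_
  by_cases hz : z ∈ spectrum ℂ T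
  · have := h z hz
    rw [geometricMultiplicity_eq_finrank_eigenspace,
      algebraicMultiplicity_eq_finrank_maxGenEigenspace] at this
    exact (Submodule.eq_of_le_of_finrank_eq
      (Module.End.genEigenspace_le_maximal (toLin' T) z 1) this).ge
  -- Off the spectrum `T - z` is injective, hence so are its powers, and the generalized eigenspace
  -- is zero.
  · rw [← spectrum_toLin', ← Module.End.hasEigenvalue_iff_mem_spectrum] at hz
    intro v hv
    obtain ⟨k, hk⟩ := (Module.End.mem_maxGenEigenspace (toLin' T) z v).1 hv
    have hinj : Function.Injective ((toLin' T) - z • (1 : Module.End ℂ (Fin n → ℂ))) := by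
      rw [← LinearMap.ker_eq_bot]
      have : Module.End.eigenspace (toLin' T) z = ⊥ := not_not.1 hz
      rw [← this, Module.End.eigenspace_def]
    have : v = 0 := by
      rw [Module.End.coe_pow] at hk
      apply hinj.iterate k
      rw [hk, iterate_map_zero]
    simp [this]

/-! ### Nullities of diagonal matrices -/

theorem rank_add_matrixNullity {n : ℕ} (A : Matrix (Fin n) (Fin n) ℂ) :
    A.rank + matrixNullity A = n := by
  exact (LinearMap.finrank_range_add_finrank_ker A.mulVecLin).trans (Module.finrank_fin_fun ℂ)

theorem matrixNullity_diagonal {n : ℕ} (d : Fin n → ℂ) :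
    matrixNullity (diagonal d) = (Finset.univ.filter fun i => d i = 0).card := by
  classical
  have h := rank_add_matrixNullity (diagonal d)
  rw [rank_diagonal, Fintype.card_subtype] at h
  have := Finset.card_filter_add_card_filter_not (s := Finset.univ) (fun i => d i = 0)
  simp only [ne_eq, Finset.card_univ, Fintype.card_fin] at h this
  omega

theorem finsum_matrixNullity_diagonal {n : ℕ} (r : Fin n → ℝ) (s : Set ℝ)
    [DecidablePred (· ∈ s)] :
    (∑ᶠ c ∈ s, matrixNullity (diagonal (fun i => (r i : ℂ)) -
      (c : ℂ) • (1 : Matrix (Fin n) (Fin n) ℂ))) =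
    (Finset.univ.filter fun i => r i ∈ s).card := by
  classical
  have h1 : ∀ c : ℝ, matrixNullity (diagonal (fun i => (r i : ℂ)) -
      (c : ℂ) • (1 : Matrix (Fin n) (Fin n) ℂ)) =
      (Finset.univ.filter fun i => r i = c).card := fun c => by
    rw [smul_one_eq_diagonal, diagonal_sub, matrixNullity_diagonal]
    simp [sub_eq_zero]
  simp only [h1]
  rw [finsum_mem_eq_sum_of_inter_support_eq (t := (Finset.univ.image r).filter (· ∈ s))]
  · rw [Finset.card_eq_sum_card_fiberwise (f := r) (t := (Finset.univ.image r).filter (· ∈ s))]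
    · refine Finset.sum_congr rfl fun c hc => ?_
      congr 1
      ext i
      simp only [Finset.mem_filter, Finset.mem_univ, true_and] at hc ⊢
      exact ⟨fun h => ⟨h ▸ hc.2, h⟩, fun h => h.2⟩
    · intro i hi
      simpa using hi
  · ext c
    simp only [Set.mem_inter_iff, Function.mem_support, Finset.coe_filter, Finset.mem_image,
      Finset.mem_univ, true_and, Set.mem_ofPred_eq, ne_eq, Finset.card_eq_zero,
      Finset.filter_eq_empty_iff, not_forall, not_not]
    grind
-- Necessity: consequences of the equation
open scoped ComplexOrder
section
variable {n : ℕ} {X : Matrix (Fin n) (Fin n) ℂ}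

/-- On the range of `X`, the equation `X X* X = X²` says that `X` acts as `X X*`. -/
theorem mul_conjTranspose_mulVec_eq (hX : X * Xᴴ * X - X ^ 2 = 0) {c : ℂ} (hc : c ≠ 0)
    {u v : Fin n → ℂ} (h : X *ᵥ u = c • v) : (X * Xᴴ) *ᵥ v = X *ᵥ v := by
  have h1 : (X * Xᴴ) *ᵥ (c • v) = X *ᵥ (c • v) := by
    rw [← h, mulVec_mulVec, mulVec_mulVec, sub_eq_zero.1 hX, sq]
  rw [mulVec_smul, mulVec_smul] at h1
  exact smul_right_injective _ hc h1

theorem star_dotProduct_mul_conjTranspose_mulVec (v w : Fin n → ℂ) :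
    star v ⬝ᵥ ((X * Xᴴ) *ᵥ w) = star ((X * Xᴴ) *ᵥ v) ⬝ᵥ w := by
  rw [dotProduct_mulVec, star_mulVec]
  simp

/-- For `c ≠ 0`, `v` lies in the range of `X`. With `q = ‖v‖²`, this gives `‖X* v‖² = c q` and `‖X*
v - v‖² = (1 - c) q`, both nonnegative. -/
theorem eigenvalue_mem_Icc (hX : X * Xᴴ * X - X ^ 2 = 0) {c : ℂ} {v : Fin n → ℂ} (hv : v ≠ 0)
    (h : X *ᵥ v = c • v) : ∃ r ∈ Set.Icc (0 : ℝ) 1, (r : ℂ) = c := by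
  by_cases hc : c = 0
  · exact ⟨0, by simp, by simp [hc]⟩
  have h1 := mul_conjTranspose_mulVec_eq hX hc h
  set q := star v ⬝ᵥ v with hq
  have hqpos : 0 < q := dotProduct_star_self_pos_iff.2 hv
  have hp : star (Xᴴ *ᵥ v) ⬝ᵥ (Xᴴ *ᵥ v) = c * q := by
    rw [star_mulVec, ← dotProduct_mulVec, mulVec_mulVec, conjTranspose_conjTranspose, h1, h,
      dotProduct_smul, smul_eq_mul]
  have hp0 : 0 ≤ c * q := hp ▸ dotProduct_star_self_nonneg _
  have hm : star (Xᴴ *ᵥ v) ⬝ᵥ v = c * q := by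
    rw [star_mulVec, ← dotProduct_mulVec, conjTranspose_conjTranspose, h,
      dotProduct_smul, smul_eq_mul]
  have hm' : star v ⬝ᵥ (Xᴴ *ᵥ v) = c * q := by
    have h2 : star (star (Xᴴ *ᵥ v) ⬝ᵥ v) = star v ⬝ᵥ (Xᴴ *ᵥ v) := by
      rw [star_dotProduct, star_star, dotProduct_comm]
    rw [← h2, hm]
    exact (IsSelfAdjoint.of_nonneg hp0).star_eq
  have hn : 0 ≤ q - c * q := by
    have h3 := dotProduct_star_self_nonneg (Xᴴ *ᵥ v - v)
    rw [star_sub, sub_dotProduct, dotProduct_sub, dotProduct_sub, hp, hm, hm', ← hq] at h3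
    simpa using h3
  obtain ⟨s, hs⟩ : ∃ s : ℝ, (s : ℂ) = q := ⟨q.re, by
    rw [Complex.lt_def] at hqpos
    exact Complex.ext rfl hqpos.2⟩
  rw [← hs] at hqpos hp0 hn
  have hs0 : 0 < s := by exact_mod_cast hqpos
  simp only [Complex.le_def, Complex.sub_re, Complex.re_mul_ofReal, Complex.im_mul_ofReal,
    Complex.zero_re, Complex.zero_im, Complex.ofReal_re] at hp0 hn
  refine ⟨c.re, ⟨?_, ?_⟩, Complex.ext rfl ?_⟩
  · exact nonneg_of_mul_nonneg_left hp0.1 hs0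
  · nlinarith [hn.1]
  · have := hp0.2.symm
    rcases mul_eq_zero.1 this with h | h
    · simp [h]
    · exact absurd h hs0.ne'

/-- This excludes Jordan chains of length two, and by induction all longer ones. -/
theorem mulVec_eq_smul_of_sub_mulVec_sub (hX : X * Xᴴ * X - X ^ 2 = 0) {c : ℂ} {v : Fin n → ℂ}
    (h : X *ᵥ (X *ᵥ v - c • v) = c • (X *ᵥ v - c • v)) : X *ᵥ v = c • v := by
  by_cases hc : c = 0
  · subst hc
    simp only [zero_smul, sub_zero] at h ⊢
    rw [mulVec_mulVec, ← sq, ← sub_eq_zero.1 hX, mul_assoc, ← mulVec_mulVec] at h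
    have h1 : (Xᴴ * X) *ᵥ v = 0 := by
      rw [← conjTranspose_mul_self_mulVec_eq_zero, mulVec_mulVec] at h
      have h2 : ((Xᴴ * X)ᴴ * (Xᴴ * X)) *ᵥ v = 0 := by
        simpa [conjTranspose_mul, mul_assoc] using h
      exact (conjTranspose_mul_self_mulVec_eq_zero _ _).1 h2
    exact (conjTranspose_mul_self_mulVec_eq_zero _ _).1 h1
  by_contra hne
  set w := X *ᵥ v - c • v with hw
  have hw0 : w ≠ 0 := sub_ne_zero.2 hne
  obtain ⟨r, -, hr⟩ := eigenvalue_mem_Icc hX hw0 h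
  have h1 := mul_conjTranspose_mulVec_eq hX hc h
  -- This puts `v` in the range of `X` as well, so self-adjointness of `X X*` and reality of `c`
  -- give `⟨w, w⟩ = ⟨X X* w, v⟩ - c ⟨w, v⟩ = 0`.
  have h2 : X *ᵥ (v - c⁻¹ • w) = c • v := by
    rw [mulVec_sub, mulVec_smul, h, smul_smul, inv_mul_cancel₀ hc, one_smul, hw]
    abel
  have h3 := mul_conjTranspose_mulVec_eq hX hc h2
  apply hw0
  apply dotProduct_star_self_eq_zero.1
  nth_rewrite 2 [hw]
  rw [← h3, dotProduct_sub, star_dotProduct_mul_conjTranspose_mulVec, h1, h, ← hr]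
  simp

theorem maxGenEigenspace_eq_eigenspace (hX : X * Xᴴ * X - X ^ 2 = 0) (z : ℂ) :
    Module.End.maxGenEigenspace (toLin' X) z = Module.End.eigenspace (toLin' X) z := by
  refine le_antisymm (fun v hv => ?_) (Module.End.genEigenspace_le_maximal (toLin' X) z 1)
  obtain ⟨k, hk⟩ := (Module.End.mem_maxGenEigenspace (toLin' X) z v).1 hv
  rw [Module.End.mem_eigenspace_iff, toLin'_apply]
  clear hv
  induction k generalizing v with
  | zero => simp only [pow_zero, Module.End.one_apply] at hk; simp [hk]
  | succ k ih =>
    rw [pow_succ, Module.End.mul_apply] at hk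
    apply mulVec_eq_smul_of_sub_mulVec_sub hX
    simpa using ih _ hk

/-- The eigenvalues of `X` in `(0,1)`, with multiplicity, are at most as many as the nullity. -/
theorem card_Ioo_le_matrixNullity (hX : X * Xᴴ * X - X ^ 2 = 0) {r : Fin n → ℝ}
    (h : IsConj X (diagonal fun i => (r i : ℂ))) :
    (Finset.univ.filter fun i => r i ∈ Set.Ioo (0 : ℝ) 1).card ≤ matrixNullity X := by
  classical
  obtain ⟨u, hu⟩ := h.symm
  let Q : Matrix (Fin n) (Fin n) ℂ := u
  have hQ : X * Q = Q * diagonal fun i => (r i : ℂ) := hu.eq.symm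
  let D (f : ℝ → ℂ) : Matrix (Fin n) (Fin n) ℂ :=
    diagonal fun i => if r i ∈ Set.Ioo (0 : ℝ) 1 then f (r i) else 0
  let P := D fun _ => 1
  -- The columns of `Q * P` are eigenvectors for eigenvalues other than 0 and 1, so they lie in the
  -- ranges of both `X` and `1 - X`.
  have h1 : X * (Q * D fun x => (x : ℂ)⁻¹) = Q * P := by
    rw [← mul_assoc, hQ, mul_assoc, diagonal_mul_diagonal]
    congr 2
    ext i
    split_ifs with hi
    · exact mul_inv_cancel₀ (by exact_mod_cast hi.1.ne')
    · simp
  have h2 : (1 - X) * (Q * D fun x => (1 - (x : ℂ))⁻¹) = Q * P := by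
    rw [← mul_assoc, sub_mul, hQ, one_mul, sub_mul, mul_assoc, diagonal_mul_diagonal, ← mul_sub,
      diagonal_sub]
    congr 2
    ext i
    split_ifs with hi
    · rw [← one_sub_mul]
      exact mul_inv_cancel₀ (sub_ne_zero.2 (by exact_mod_cast hi.2.ne'))
    · simp
  let M := (Xᴴ - 1) * (Q * P)
  have hXM : X * M = 0 := by
    have : X * Xᴴ * (Q * P) = X * (Q * P) := by
      rw [← h1, ← mul_assoc, ← mul_assoc X X, ← sq, sub_eq_zero.1 hX]
    rw [← mul_assoc, mul_sub, sub_mul, this, mul_one, sub_self]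
  have hker : ∀ a, M *ᵥ a = 0 → P *ᵥ a = 0 := fun a ha => by
    -- A vector killed by `X* - 1` is orthogonal to the range of `1 - X`, which contains this vector
    -- itself.
    have h3 : (Q * P) *ᵥ a = 0 := by
      have h4 (w : Fin n → ℂ) :
          star w ᵥ* (1 - X) = -star ((Xᴴ - 1) *ᵥ w) := by
        rw [star_mulVec, conjTranspose_sub, conjTranspose_conjTranspose, conjTranspose_one,
          ← vecMul_neg, neg_sub]
      apply dotProduct_star_self_eq_zero.1
      nth_rewrite 2 [← h2]
      rw [← mulVec_mulVec _ (1 - X), dotProduct_mulVec, h4, mulVec_mulVec, ha]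
      simp
    rw [← mulVec_mulVec] at h3
    exact mulVec_injective_of_isUnit u.isUnit (h3.trans (mulVec_zero _).symm)
  have h5 : matrixNullity M ≤ matrixNullity P :=
    Submodule.finrank_mono fun a ha => by simpa using hker a (by simpa using ha)
  have h6 : M.rank ≤ matrixNullity X := by
    refine Submodule.finrank_mono ?_
    rintro _ ⟨a, rfl⟩
    simp [hXM]
  have h7 := rank_add_matrixNullity M
  have h8 := rank_add_matrixNullity P
  have h9 : P.rank = (Finset.univ.filter fun i => r i ∈ Set.Ioo (0 : ℝ) 1).card := by
    rw [rank_diagonal, Fintype.card_subtype]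
    congr 1
    ext i
    simp
  omega
end

/-! ### Sufficiency: construction of `X` -/

/-- The algebra behind the construction: `D` is the diagonal form, `N` its perturbation. -/
theorem exists_isConj_of_perturbation {n : ℕ} (D N M : Matrix (Fin n) (Fin n) ℂ) (hD : Dᴴ = D)
    (hND : N * D = 0) (hNN : N * N = 0) (hN : N * Nᴴ = D - D * D) (hDM : D * M = N)
    (hMD : M * D = 0) (hNM : N * M = 0) (hMM : M * M = 0) :
    ∃ X : Matrix (Fin n) (Fin n) ℂ, X * Xᴴ * X - X ^ 2 = 0 ∧ IsConj D X := by
  refine ⟨D + N, ?_, ⟨⟨1 - M, 1 + M, ?_, ?_⟩, ?_⟩⟩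
  · have hDN : D * Nᴴ = 0 := by
      simpa [conjTranspose_mul, hD] using congrArg conjTranspose hND
    have : (D + N) * (D + N)ᴴ = D := by
      rw [conjTranspose_add, hD, add_mul, mul_add, mul_add, hDN, hND, hN]
      abel
    rw [this, sq, add_mul, mul_add N, hND, hNN]
    simp
  · rw [sub_mul, mul_add, mul_add, hMM]; simp
  · rw [add_mul, mul_sub, mul_sub, hMM]; simp
  · change (1 - M) * D = (D + N) * (1 - M)
    rw [sub_mul, add_mul, mul_sub, mul_sub, hMD, hDM, hNM]
    simp

section
variable {n : ℕ} {r : Fin n → ℝ} (φ : {i // r i ∈ Set.Ioo (0 : ℝ) 1} → {i // r i = 0})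

open Classical in
/-- The matrix with entry `f (r i)` at `(i, φ i)` for each `i` with `0 < r i < 1`. -/
noncomputable def couplingMatrix (f : ℝ → ℝ) : Matrix (Fin n) (Fin n) ℂ := fun i j =>
  if h : r i ∈ Set.Ioo (0 : ℝ) 1 then if (φ ⟨i, h⟩ : Fin n) = j then (f (r i) : ℂ) else 0 else 0

theorem couplingMatrix_apply_of_mem (f : ℝ → ℝ) {i : Fin n} (h : r i ∈ Set.Ioo (0 : ℝ) 1)
    (j : Fin n) : couplingMatrix φ f i j = if (φ ⟨i, h⟩ : Fin n) = j then (f (r i) : ℂ) else 0 := by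
  simp only [couplingMatrix, dif_pos h]

theorem couplingMatrix_apply_of_notMem (f : ℝ → ℝ) {i : Fin n} (h : r i ∉ Set.Ioo (0 : ℝ) 1)
    (j : Fin n) : couplingMatrix φ f i j = 0 :=
  dif_neg h

theorem row_mem_of_couplingMatrix_ne_zero {f : ℝ → ℝ} {i j : Fin n}
    (h : couplingMatrix φ f i j ≠ 0) : r i ∈ Set.Ioo (0 : ℝ) 1 := by
  by_contra hi
  exact h (couplingMatrix_apply_of_notMem φ f hi j)

theorem col_eq_zero_of_couplingMatrix_ne_zero {f : ℝ → ℝ} {i j : Fin n}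
    (h : couplingMatrix φ f i j ≠ 0) : r j = 0 := by
  have hi := row_mem_of_couplingMatrix_ne_zero φ h
  rw [couplingMatrix_apply_of_mem φ f hi] at h
  rw [← (ite_ne_right_iff.1 h).1]
  exact (φ ⟨i, hi⟩).2

/-- Nonzero rows have `r` in `(0,1)` and nonzero columns have `r = 0`, so no intermediate index
contributes. -/
theorem couplingMatrix_mul_couplingMatrix (f g : ℝ → ℝ) :
    couplingMatrix φ f * couplingMatrix φ g = 0 := by
  ext i k
  rw [mul_apply, Matrix.zero_apply]
  refine Finset.sum_eq_zero fun j _ => ?_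
  by_contra h
  obtain ⟨h1, h2⟩ := mul_ne_zero_iff.1 h
  exact (row_mem_of_couplingMatrix_ne_zero φ h2).1.ne'
    (col_eq_zero_of_couplingMatrix_ne_zero φ h1)

theorem couplingMatrix_mul_diagonal (f : ℝ → ℝ) :
    couplingMatrix φ f * (diagonal fun i => (r i : ℂ)) = 0 := by
  ext i j
  rw [mul_diagonal, Matrix.zero_apply]
  by_cases h : couplingMatrix φ f i j = 0
  · rw [h, zero_mul]
  · rw [col_eq_zero_of_couplingMatrix_ne_zero φ h, Complex.ofReal_zero, mul_zero]

theorem diagonal_mul_couplingMatrix (f : ℝ → ℝ) :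
    (diagonal fun i => (r i : ℂ)) * couplingMatrix φ (fun x => f x / x) = couplingMatrix φ f := by
  ext i j
  rw [diagonal_mul]
  by_cases hi : r i ∈ Set.Ioo (0 : ℝ) 1
  · rw [couplingMatrix_apply_of_mem φ _ hi, couplingMatrix_apply_of_mem φ _ hi, mul_ite, mul_zero,
      ← Complex.ofReal_mul, mul_div_cancel₀ _ hi.1.ne']
  · rw [couplingMatrix_apply_of_notMem φ _ hi, couplingMatrix_apply_of_notMem φ _ hi, mul_zero]

/-- Injectivity of `φ` makes distinct rows orthogonal. -/
theorem couplingMatrix_mul_conjTranspose {φ : {i // r i ∈ Set.Ioo (0 : ℝ) 1} → {i // r i = 0}}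
    (hφ : Function.Injective φ) (f : ℝ → ℝ) {g : ℝ → ℝ}
    (hfg : ∀ x ∈ Set.Ioo (0 : ℝ) 1, f x * f x = g x)
    (hg : ∀ i, r i ∉ Set.Ioo (0 : ℝ) 1 → g (r i) = 0) :
    couplingMatrix φ f * (couplingMatrix φ f)ᴴ = diagonal fun i => (g (r i) : ℂ) := by
  ext i k
  rw [mul_apply]
  simp only [conjTranspose_apply]
  by_cases hi : r i ∈ Set.Ioo (0 : ℝ) 1
  · simp only [couplingMatrix_apply_of_mem φ f hi, ite_mul, zero_mul, Finset.sum_ite_eq,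
      Finset.mem_univ, if_true]
    by_cases hk : r k ∈ Set.Ioo (0 : ℝ) 1
    · rw [couplingMatrix_apply_of_mem φ f hk]
      by_cases hik : i = k
      · subst hik
        rw [if_pos rfl, diagonal_apply_eq, ← hfg _ hi, RCLike.star_def, Complex.conj_ofReal,
          Complex.ofReal_mul]
      · have hne : (φ ⟨k, hk⟩ : Fin n) ≠ φ ⟨i, hi⟩ := fun h =>
          hik (Subtype.mk.inj (hφ (Subtype.ext h))).symm
        rw [if_neg hne, diagonal_apply_ne _ hik, star_zero, mul_zero]
    · have hik : i ≠ k := fun h => hk (h ▸ hi)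
      rw [couplingMatrix_apply_of_notMem φ f hk, diagonal_apply_ne _ hik, star_zero, mul_zero]
  · simp only [couplingMatrix_apply_of_notMem φ f hi, zero_mul, Finset.sum_const_zero,
      diagonal_apply, hg i hi, Complex.ofReal_zero, ite_self]

end

theorem exists_isConj_diagonal_of_card_le {n : ℕ} (r : Fin n → ℝ)
    (hr : ∀ i, r i ∈ Set.Icc (0 : ℝ) 1)
    (hcard : (Finset.univ.filter fun i => r i ∈ Set.Ioo (0 : ℝ) 1).card ≤
      (Finset.univ.filter fun i => r i = 0).card) :
    ∃ X : Matrix (Fin n) (Fin n) ℂ,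
      X * Xᴴ * X - X ^ 2 = 0 ∧ IsConj (diagonal fun i => (r i : ℂ)) X := by
  rw [← Fintype.card_subtype, ← Fintype.card_subtype] at hcard
  obtain ⟨φ⟩ := Function.Embedding.nonempty_of_card_le hcard
  have hN := couplingMatrix_mul_conjTranspose φ.injective (fun x => √(x - x * x))
    (g := fun x => x - x * x)
    (fun x hx => Real.mul_self_sqrt (by nlinarith [hx.1, hx.2]))
    -- Outside `(0,1)` only 0 and 1 remain, the roots of `x - x²`.
    (fun i hi => by
      rcases (hr i).1.eq_or_lt with h | h
      · simp [← h]
      · have : r i = 1 := le_antisymm (hr i).2 (not_lt.1 fun h' => hi ⟨h, h'⟩)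
        simp [this])
  refine exists_isConj_of_perturbation (diagonal fun i => (r i : ℂ))
    (couplingMatrix φ fun x => √(x - x * x)) (couplingMatrix φ fun x => √(x - x * x) / x)
    ?_ (couplingMatrix_mul_diagonal φ _)
    (couplingMatrix_mul_couplingMatrix φ _ _) ?_ (diagonal_mul_couplingMatrix φ _)
    (couplingMatrix_mul_diagonal φ _) (couplingMatrix_mul_couplingMatrix φ _ _)
    (couplingMatrix_mul_couplingMatrix φ _ _)
  · rw [diagonal_conjTranspose]
    congr 1
    ext i
    simp
  · rw [hN, diagonal_mul_diagonal, diagonal_sub]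
    simp

/-! ### Both directions assembled -/

theorem mainTheorem2 {n : ℕ} (T : Matrix (Fin n) (Fin n) ℂ) :
    (∃ X : Matrix (Fin n) (Fin n) ℂ,
        X * X.conjTranspose * X - X ^ 2 = 0 ∧ IsConj T X) ↔
      (spectrum ℂ T ⊆ (fun c : ℝ => (c : ℂ)) '' Set.Icc (0 : ℝ) 1) ∧
      (∀ z ∈ spectrum ℂ T, geometricMultiplicity T z = algebraicMultiplicity T z) ∧
      (∑ᶠ c ∈ Set.Ioo (0 : ℝ) 1,
          matrixNullity (T - (c : ℂ) • (1 : Matrix (Fin n) (Fin n) ℂ))) ≤ matrixNullity T := by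
  have hdiag : ∀ {r : Fin n → ℝ}, IsConj T (diagonal fun i => (r i : ℂ)) →
      (∑ᶠ c ∈ Set.Ioo (0 : ℝ) 1,
        matrixNullity (T - (c : ℂ) • (1 : Matrix (Fin n) (Fin n) ℂ))) =
      (Finset.univ.filter fun i => r i ∈ Set.Ioo (0 : ℝ) 1).card := fun hr => by
    refine Eq.trans ?_ (finsum_matrixNullity_diagonal _ (Set.Ioo (0 : ℝ) 1))
    exact finsum_congr fun c => finsum_congr fun _ =>
      matrixNullity_eq_of_isConj (isConj_sub_smul_one hr c)
  have hreal : ∀ {d : Fin n → ℂ}, IsConj T (diagonal d) →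
      spectrum ℂ T ⊆ (fun c : ℝ => (c : ℂ)) '' Set.Icc (0 : ℝ) 1 →
      ∃ r : Fin n → ℝ, (∀ i, r i ∈ Set.Icc (0 : ℝ) 1) ∧ d = fun i => (r i : ℂ) :=
    fun {d} hd ha => by
      rw [spectrum_eq_of_isConj hd, spectrum_diagonal] at ha
      choose r hr hrd using fun i => ha (Set.mem_range_self i)
      exact ⟨r, hr, funext fun i => (hrd i).symm⟩
  constructor
  · rintro ⟨X, hX, hTX⟩
    have ha : spectrum ℂ T ⊆ (fun c : ℝ => (c : ℂ)) '' Set.Icc (0 : ℝ) 1 := fun z hz => by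
      rw [spectrum_eq_of_isConj hTX, ← spectrum_toLin',
        ← Module.End.hasEigenvalue_iff_mem_spectrum] at hz
      obtain ⟨v, hv⟩ := hz.exists_hasEigenvector
      exact eigenvalue_mem_Icc hX hv.2 (mulVec_eq_smul_of_mem_eigenspace hv.1)
    have hb : ∀ z ∈ spectrum ℂ T, geometricMultiplicity T z = algebraicMultiplicity T z :=
      fun z _ => by
        rw [geometricMultiplicity_eq_of_isConj hTX, algebraicMultiplicity,
          charpoly_eq_of_isConj hTX, ← algebraicMultiplicity,
          geometricMultiplicity_eq_finrank_eigenspace,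
          algebraicMultiplicity_eq_finrank_maxGenEigenspace, maxGenEigenspace_eq_eigenspace hX]
    refine ⟨ha, hb, ?_⟩
    obtain ⟨d, hd⟩ := exists_isConj_diagonal T hb
    obtain ⟨r, -, rfl⟩ := hreal hd ha
    rw [hdiag hd, matrixNullity_eq_of_isConj hTX]
    exact card_Ioo_le_matrixNullity hX (hTX.symm.trans hd)
  · rintro ⟨ha, hb, hc⟩
    obtain ⟨d, hd⟩ := exists_isConj_diagonal T hb
    obtain ⟨r, hr, rfl⟩ := hreal hd ha
    rw [hdiag hd, matrixNullity_eq_of_isConj hd, matrixNullity_diagonal] at hc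
    simp only [Complex.ofReal_eq_zero] at hc
    obtain ⟨X, hX, hDX⟩ := exists_isConj_diagonal_of_card_le r hr hc
    exact ⟨X, hX, hd.trans hDX⟩
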